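/- Graphs are finite and may have loops and parallel edges. For a graph $G$ and an edge set $X$, let $G\langle X\rangle$ be the subgraph whose edges are those of $X$ and whose vertices are the ends of the edges of $X$; let $\Delta G=|E(G)|-|V(G)|$. A cacti-graph is a graph with no isolated vertices, no leaves (vertices of degree $1$, a loop counting twice) and no component that is a cycle. For $k\ge 1$ the $k$-circular matroid $M_k(G)$ is the matroid on $E(G)$ whose circuits are the sets $C\subseteq E(G)$ such that $G\langle C\rangle$ is a cacti-graph with $\Delta G\langle C\rangle=k$. A matroid is connected if it has no loops, no coloops, and every two of its elements lie in a common circuit; a non-separating cocircuit of a connected matroid $M$ is a cocircuit $K$ such that $M\setminus K$ is connected. Write $S(x,G)$ for the set of edges incident to the vertex $x$ and $\mathcal S(G)=\{S(x,G):x\in V(G)\}$. A vertex $x$ is $k$-big if $|S(x,G)|>\rho_k^*(G)+1$, where $\rho_k^*(G)$ is the rank of the dual of $M_k(G)$. Graphs $G,G'$ with $E(G)=E(G')$ are strongly isomorphic if there is a bijection $\nu:V(G)\to V(G')$ such that every edge has ends $x,y$ in $G$ if and only if it has ends $\nu(x),\nu(y)$ in $G'$. **Theorem.** Let $k\ge 1$,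 and let $G$ and $G'$ be finite graphs without isolated vertices. Suppose that $M_k(G)$ is connected and that $v$ is a vertex of $G$ such that 1. $S(x,G)$ is a non-separating cocircuit of $M_k(G)$ for every vertex $x\ne v$ of $G$; 2. every loop of $G$ is incident to $v$; 3. $v$ is not $k$-big; 4. $G\setminus v$ has no component that is a tree (a single vertex without edges being a tree). If $M_k(G')=M_k(G)$, then $\mathcal S(G)=\mathcal S(G')$, and $G$ and $G'$ are strongly isomorphic. -/

import Mathlib

namespace Graph

open Set

variable {α α' β : Type*}

/-! ### Finite multigraphs -/

/-- A finite graph (parallel edges and loops are allowed). -/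
def IsFinite (G : Graph α β) : Prop := V(G).Finite ∧ E(G).Finite

/-- `G` has no isolated vertex: every vertex is an end of some edge. -/
def NoIsolatedVertex (G : Graph α β) : Prop := ∀ x ∈ V(G), ∃ e, G.Inc e x

/-- The degree of a vertex; a loop counts twice. -/
noncomputable def eDegree (G : Graph α β) (x : α) : ℕ∞ :=
  (G.incidenceSet x).encard + (G.loopSet x).encard

/-- A leaf is a vertex of degree one. -/
def IsLeaf (G : Graph α β) (x : α) : Prop := x ∈ V(G) ∧ G.eDegree x = 1

/-- `G` is connected: it has a vertex, and any two vertices are joined by a walk. -/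
def IsConnected (G : Graph α β) : Prop :=
  V(G).Nonempty ∧ ∀ x ∈ V(G), ∀ y ∈ V(G), Relation.ReflTransGen G.Adj x y

/-- `H` is a (connected) component of `G`. -/
def IsComponent (H G : Graph α β) : Prop := H ≤c G ∧ H.IsConnected

/-- `G` is a cycle: a finite connected graph in which every vertex has degree two.  A loop with its
vertex, and a pair of parallel edges with their ends, are cycles. -/
def IsCycleGraph (G : Graph α β) : Prop :=
  V(G).Finite ∧ G.IsConnected ∧ ∀ x ∈ V(G), G.eDegree x = 2

/-- `G` is a tree: connected, without a subgraph that is a cycle.  A single vertex is a tree. -/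
def IsTreeGraph (G : Graph α β) : Prop := G.IsConnected ∧ ∀ H ≤ G, ¬ H.IsCycleGraph

/-- `G` is a cacti-graph: no isolated vertices, no leaves, and no cycle components. -/
def IsCacti (G : Graph α β) : Prop :=
  G.NoIsolatedVertex ∧ (∀ x, ¬ G.IsLeaf x) ∧
    ∀ H : Graph α β, H.IsComponent G → ¬ H.IsCycleGraph

/-- `Δ G = |E(G)| - |V(G)|`, for a finite graph `G`. -/
noncomputable def excess (G : Graph α β) : ℤ := (E(G).ncard : ℤ) - (V(G).ncard : ℤ)

/-- The set of all ends of edges in `X`. -/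
def ends (G : Graph α β) (X : Set β) : Set α := {x | ∃ e ∈ X, G.Inc e x}

/-- The subgraph `G⟨X⟩` of `G` induced by a set `X` of edges: its edges are those in `X`, its
vertices are the ends of these. -/
def edgeInduce (G : Graph α β) (X : Set β) : Graph α β := (G.restrict X).induce (G.ends X)

/-- The family `𝒞ₖ(G)` of all edge sets `C` such that `Δ G⟨C⟩ = k` and `G⟨C⟩` is a cacti-graph. -/
def circuitFamily (G : Graph α β) (k : ℕ) : Set (Set β) :=
  {C | C ⊆ E(G) ∧ (G.edgeInduce C).excess = k ∧ (G.edgeInduce C).IsCacti}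

/-- The star `S(x, G)` of a vertex `x`: the set of edges incident to `x`. -/
def vertexStar (G : Graph α β) (x : α) : Set β := {e | G.Inc e x}

/-- The set `𝒮(G)` of all vertex stars of `G`. -/
def vertexStars (G : Graph α β) : Set (Set β) := {S | ∃ x ∈ V(G), S = G.vertexStar x}

/-- Two graphs on the same edge set are strongly isomorphic if some bijection of their vertex sets
carries the ends of each edge in the one to the ends of the same edge in the other. -/
def StronglyIsomorphic (G : Graph α β) (G' : Graph α' β) : Prop :=
  E(G) = E(G') ∧ ∃ ν : V(G) ≃ V(G'), ∀ (e : β) (x y : V(G)),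
    G.IsLink e x y ↔ G'.IsLink e (ν x) (ν y)

/-! ### Auxiliary facts, used to show that `𝒞ₖ(G)` is the set of circuits of a matroid -/

lemma vertexSet_edgeInduce (G : Graph α β) (X : Set β) : V(G.edgeInduce X) = G.ends X := rfl

lemma edgeInduce_isLink (G : Graph α β) (X : Set β) (e : β) (x y : α) :
    (G.edgeInduce X).IsLink e x y ↔ e ∈ X ∧ G.IsLink e x y := by
  constructor
  · rintro ⟨h, -, -⟩
    exact h
  · rintro ⟨he, h⟩
    exact ⟨⟨he, h⟩, ⟨e, he, h.inc_left⟩, ⟨e, he, h.inc_right⟩⟩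

lemma edgeInduce_inc (G : Graph α β) (X : Set β) (e : β) (x : α) :
    (G.edgeInduce X).Inc e x ↔ e ∈ X ∧ G.Inc e x := by
  simp [Inc, edgeInduce_isLink]

lemma edgeSet_edgeInduce (G : Graph α β) {X : Set β} (hX : X ⊆ E(G)) :
    E(G.edgeInduce X) = X := by
  ext e
  rw [edge_mem_iff_exists_isLink]
  simp only [edgeInduce_isLink]
  constructor
  · rintro ⟨x, y, h, -⟩
    exact h
  · intro h
    obtain ⟨x, y, hxy⟩ := G.exists_isLink_of_mem_edgeSet (hX h)
    exact ⟨x, y, h, hxy⟩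

lemma ends_mono (G : Graph α β) {X Y : Set β} (h : X ⊆ Y) : G.ends X ⊆ G.ends Y := by
  rintro x ⟨e, he, hx⟩
  exact ⟨e, h he, hx⟩

lemma ends_union (G : Graph α β) (X Y : Set β) : G.ends (X ∪ Y) = G.ends X ∪ G.ends Y := by
  ext x
  simp only [ends, mem_union, mem_ofPred_eq]
  constructor
  · rintro ⟨e, he | he, hx⟩
    · exact Or.inl ⟨e, he, hx⟩
    · exact Or.inr ⟨e, he, hx⟩
  · rintro (⟨e, he, hx⟩ | ⟨e, he, hx⟩)
    · exact ⟨e, Or.inl he, hx⟩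
    · exact ⟨e, Or.inr he, hx⟩

lemma ends_inter_subset (G : Graph α β) (X Y : Set β) :
    G.ends (X ∩ Y) ⊆ G.ends X ∩ G.ends Y :=
  subset_inter (G.ends_mono inter_subset_left) (G.ends_mono inter_subset_right)

lemma finite_ends (G : Graph α β) {X : Set β} (hX : X.Finite) : (G.ends X).Finite := by
  have h : G.ends X = ⋃ e ∈ X, {x | G.Inc e x} := by
    ext x
    simp [ends]
  rw [h]
  refine hX.biUnion fun e _ => ?_
  by_cases he : ∃ x y, G.IsLink e x y
  · obtain ⟨x, y, hxy⟩ := he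
    refine (Set.toFinite {x, y}).subset fun z hz => ?_
    simpa using Inc.eq_or_eq_of_isLink hz hxy
  · refine Set.finite_empty.subset fun z hz => ?_
    obtain ⟨y, hy⟩ := hz
    exact he ⟨z, y, hy⟩

open Classical in
/-- The number of times that `x` is an end of `e`. -/
noncomputable def multEnd (G : Graph α β) (e : β) (x : α) : ℕ :=
  (if G.Inc e x then 1 else 0) + (if G.IsLoopAt e x then 1 else 0)

open Classical in
lemma sum_multEnd (G : Graph α β) {e : β} {x y : α} (h : G.IsLink e x y) (W : Finset α) :
    ∑ w ∈ W, G.multEnd e w = (if x ∈ W then 1 else 0) + (if y ∈ W then 1 else 0) := by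
  have key : ∀ w, G.multEnd e w = (if x = w then 1 else 0) + (if y = w then 1 else 0) := by
    intro w
    have h1 : G.Inc e w ↔ x = w ∨ y = w := by
      constructor
      · intro hw
        rcases hw.eq_or_eq_of_isLink h with rfl | rfl
        · exact Or.inl rfl
        · exact Or.inr rfl
      · rintro (rfl | rfl)
        · exact h.inc_left
        · exact h.inc_right
    have h2 : G.IsLoopAt e w ↔ x = w ∧ y = w := by
      constructor
      · intro hw
        exact ⟨(hw.eq_of_inc h.inc_left).symm, (hw.eq_of_inc h.inc_right).symm⟩
      · rintro ⟨rfl, rfl⟩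
        exact h
    simp only [multEnd, h1, h2]
    by_cases hx : x = w <;> by_cases hy : y = w <;> simp [hx, hy]
  simp only [key, Finset.sum_add_distrib, Finset.sum_ite_eq]

lemma eDegree_eq_sum (G : Graph α β) {D : Finset β} {x : α} (h : G.incidenceSet x ⊆ D) :
    G.eDegree x = ((∑ e ∈ D, G.multEnd e x : ℕ) : ℕ∞) := by
  classical
  have h1 : G.incidenceSet x = ((D.filter (fun e => G.Inc e x) : Finset β) : Set β) := by
    ext e
    simp only [Finset.coe_filter, mem_ofPred_eq, mem_incidenceSet]
    exact ⟨fun he => ⟨h he, he⟩, fun he => he.2⟩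
  have h2 : G.loopSet x = ((D.filter (fun e => G.IsLoopAt e x) : Finset β) : Set β) := by
    ext e
    simp only [Finset.coe_filter, mem_ofPred_eq, mem_loopSet]
    exact ⟨fun he => ⟨h he.inc, he⟩, fun he => he.2⟩
  rw [eDegree, h1, h2, Set.encard_coe_eq_coe_finsetCard, Set.encard_coe_eq_coe_finsetCard]
  simp only [multEnd, Finset.sum_add_distrib, Finset.card_filter]
  push_cast
  rfl

/-- A cycle has as many edges as vertices. -/
lemma IsCycleGraph.ncard_eq {H : Graph α β} (hH : H.IsCycleGraph) (hE : E(H).Finite) :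
    E(H).ncard = V(H).ncard := by
  classical
  obtain ⟨hV, -, hdeg⟩ := hH
  have h1 : ∀ x ∈ hV.toFinset, ∑ e ∈ hE.toFinset, H.multEnd e x = 2 := by
    intro x hx
    have h2 := hdeg x (by simpa using hx)
    rw [H.eDegree_eq_sum (D := hE.toFinset)
      (by simpa using H.incidenceSet_subset_edgeSet x)] at h2
    exact_mod_cast h2
  have h2 : ∀ e ∈ hE.toFinset, ∑ x ∈ hV.toFinset, H.multEnd e x = 2 := by
    intro e he
    obtain ⟨x, y, hxy⟩ := H.exists_isLink_of_mem_edgeSet (by simpa using he : e ∈ E(H))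
    rw [H.sum_multEnd hxy]
    simp [hxy.left_mem, hxy.right_mem]
  have h3 := Finset.sum_comm (s := hV.toFinset) (t := hE.toFinset) (f := fun x e => H.multEnd e x)
  rw [Finset.sum_congr rfl h1, Finset.sum_congr rfl h2] at h3
  simp only [Finset.sum_const, smul_eq_mul] at h3
  rw [Set.ncard_eq_toFinset_card _ hE, Set.ncard_eq_toFinset_card _ hV]
  omega

lemma excess_edgeInduce (G : Graph α β) {X : Set β} (hX : X ⊆ E(G)) :
    (G.edgeInduce X).excess = (X.ncard : ℤ) - ((G.ends X).ncard : ℤ) := by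
  rw [excess, edgeSet_edgeInduce G hX, vertexSet_edgeInduce]

/-- A minimal edge set of excess at least `k` belongs to `𝒞ₖ(G)`. -/
lemma mem_circuitFamily_of_minimal (G : Graph α β) {k : ℕ} (hk : 1 ≤ k) {C : Set β}
    (hCE : C ⊆ E(G)) (hfin : C.Finite) (hC : (G.ends C).ncard + k ≤ C.ncard)
    (hmin : ∀ Y ⊆ C, Y ≠ C → Y.ncard < (G.ends Y).ncard + k) : C ∈ G.circuitFamily k := by
  have hendfin := G.finite_ends hfin
  refine ⟨hCE, ?_, ?_, ?_, ?_⟩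
  · rw [excess_edgeInduce G hCE]
    have hne : C.Nonempty := by
      rw [← Set.ncard_pos hfin]
      omega
    obtain ⟨e, he⟩ := hne
    have h1 := hmin (C \ {e}) sdiff_subset
      (fun h => ((h.symm ▸ he : e ∈ C \ {e})).2 rfl)
    have h2 := Set.ncard_sdiff_singleton_add_one he hfin
    have h3 := Set.ncard_le_ncard (G.ends_mono (sdiff_subset : C \ {e} ⊆ C)) hendfin
    omega
  · rintro x ⟨e, he, hx⟩
    exact ⟨e, (edgeInduce_inc ..).2 ⟨he, hx⟩⟩
  · rintro x ⟨hxV, hdeg⟩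
    obtain ⟨e, he, hx⟩ := hxV
    have hinc : (G.edgeInduce C).incidenceSet x ⊆ {e} := by
      have hle : ((G.edgeInduce C).incidenceSet x).encard ≤ 1 := by
        rw [← hdeg, eDegree]
        exact le_self_add
      rw [Set.encard_le_one_iff] at hle
      intro f hf
      exact hle f e hf ((edgeInduce_inc ..).2 ⟨he, hx⟩)
    have h1 := hmin (C \ {e}) sdiff_subset
      (fun h => ((h.symm ▸ he : e ∈ C \ {e})).2 rfl)
    have h2 := Set.ncard_sdiff_singleton_add_one he hfin
    have h3 : G.ends (C \ {e}) ⊆ G.ends C \ {x} := by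
      rintro y ⟨f, hf, hy⟩
      refine ⟨⟨f, hf.1, hy⟩, ?_⟩
      rintro rfl
      exact hf.2 (hinc ((edgeInduce_inc ..).2 ⟨hf.1, hy⟩))
    have h4 := Set.ncard_le_ncard h3 (hendfin.subset sdiff_subset)
    have hxC : x ∈ G.ends C := ⟨e, he, hx⟩
    have h5 := Set.ncard_sdiff_singleton_add_one hxC hendfin
    omega
  · rintro H ⟨hcl, hconn⟩ hcyc
    have hHC : E(H) ⊆ C := by
      have := hcl.le.edgeSet_mono
      rwa [edgeSet_edgeInduce G hCE] at this
    have hVC : V(H) ⊆ G.ends C := hcl.le.vertexSet_mono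
    have hHfin := hfin.subset hHC
    have hVfin := hendfin.subset hVC
    have heq := hcyc.ncard_eq hHfin
    have hpos : 0 < V(H).ncard := (Set.ncard_pos hVfin).2 hconn.1
    have hne : (C \ E(H)) ≠ C := by
      intro h
      have hEne : E(H).Nonempty := by
        rw [← Set.ncard_pos hHfin]
        omega
      obtain ⟨e, he⟩ := hEne
      exact ((h.symm ▸ hHC he : e ∈ C \ E(H))).2 he
    have h1 := hmin (C \ E(H)) sdiff_subset hne
    have h2 := Set.ncard_sdiff_add_ncard_of_subset hHC hfin
    have h3 : G.ends (C \ E(H)) ⊆ G.ends C \ V(H) := by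
      rintro y ⟨f, hf, hy⟩
      refine ⟨⟨f, hf.1, hy⟩, fun hyH => hf.2 ?_⟩
      exact hcl.closed ((edgeInduce_inc ..).2 ⟨hf.1, hy⟩) hyH
    have h4 := Set.ncard_le_ncard h3 (hendfin.subset sdiff_subset)
    have h5 := Set.ncard_sdiff_add_ncard_of_subset hVC hendfin
    omega

/-- An edge set contains no member of `𝒞ₖ(G)` if and only if all its subsets have excess
less than `k`. -/
lemma forall_circuitFamily_not_subset_iff (G : Graph α β) {k : ℕ} (hk : 1 ≤ k) {I : Set β}
    (hIE : I ⊆ E(G)) (hfin : I.Finite) :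
    (∀ C ∈ G.circuitFamily k, ¬ C ⊆ I) ↔ ∀ Y ⊆ I, Y.ncard < (G.ends Y).ncard + k := by
  constructor
  · intro h
    by_contra! hcon
    let P : Set β → Prop := fun Y => Y ⊆ I ∧ (G.ends Y).ncard + k ≤ Y.ncard
    have hPfin : {Y | P Y}.Finite := hfin.finite_subsets.subset fun Y hY => hY.1
    obtain ⟨C, hC⟩ := hPfin.exists_minimal hcon
    refine h C (G.mem_circuitFamily_of_minimal hk (hC.1.1.trans hIE) (hfin.subset hC.1.1)
      hC.1.2 ?_) hC.1.1
    intro Y hYC hne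
    by_contra! hcon'
    exact hne (hYC.antisymm (hC.2 (⟨hYC.trans hC.1.1, hcon'⟩ : P Y) hYC))
  · rintro h C ⟨hCE, hex, -⟩ hCI
    rw [excess_edgeInduce G hCE] at hex
    have := h C hCI
    omega

lemma circuitFamily_aug (G : Graph α β) {k : ℕ} (hE : E(G).Finite) {I J : Set β}
    (hIE : I ⊆ E(G)) (hJE : J ⊆ E(G))
    (hI : ∀ Y ⊆ I, Y.ncard < (G.ends Y).ncard + k) (hJ : ∀ Y ⊆ J, Y.ncard < (G.ends Y).ncard + k)
    (hIJ : I.ncard < J.ncard) :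
    ∃ e ∈ J, e ∉ I ∧ ∀ Y ⊆ insert e I, Y.ncard < (G.ends Y).ncard + k := by
  by_contra! hcon
  have hIf := hE.subset hIE
  have hJf := hE.subset hJE
  -- the tight subsets of `I`, those of excess `k - 1`, are closed under unions
  have htight : ∀ Y ⊆ I, ∀ Z ⊆ I, (G.ends Y).ncard + k = Y.ncard + 1 →
      (G.ends Z).ncard + k = Z.ncard + 1 → (G.ends (Y ∪ Z)).ncard + k = (Y ∪ Z).ncard + 1 := by
    intro Y hY Z hZ h1 h2
    have hYf := hIf.subset hY
    have hZf := hIf.subset hZ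
    have h3 := hI (Y ∪ Z) (union_subset hY hZ)
    have h4 := hI (Y ∩ Z) (inter_subset_left.trans hY)
    have h5 := Set.ncard_union_add_ncard_inter Y Z hYf hZf
    have h6 := Set.ncard_union_add_ncard_inter (G.ends Y) (G.ends Z) (G.finite_ends hYf)
      (G.finite_ends hZf)
    have h7 := Set.ncard_le_ncard (G.ends_inter_subset Y Z)
      ((G.finite_ends hYf).subset inter_subset_left)
    rw [← ends_union] at h6
    omega
  -- every element of `J` outside `I` has its ends in a tight subset of `I`
  have hex : ∀ e ∈ J, e ∉ I → ∃ T ⊆ I, (G.ends T).ncard + k = T.ncard + 1 ∧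
      G.ends {e} ⊆ G.ends T := by
    intro e heJ heI
    obtain ⟨Y, hYI, hY⟩ := hcon e heJ heI
    have hYf : Y.Finite := (hIf.insert e).subset hYI
    have heY : e ∈ Y := by
      by_contra h
      have := hI Y ((subset_insert_iff_of_notMem h).1 hYI)
      omega
    have hTI : Y \ {e} ⊆ I := by
      rintro f ⟨hf, hfe⟩
      exact (hYI hf).resolve_left hfe
    have h1 := hI _ hTI
    have h2 := Set.ncard_sdiff_singleton_add_one heY hYf
    have hsub : G.ends (Y \ {e}) ⊆ G.ends Y := G.ends_mono sdiff_subset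
    have h3 := Set.ncard_le_ncard hsub (G.finite_ends hYf)
    refine ⟨Y \ {e}, hTI, by omega, ?_⟩
    rw [Set.eq_of_subset_of_ncard_le hsub (by omega) (G.finite_ends hYf)]
    exact G.ends_mono (by simpa using heY)
  -- hence a single tight subset of `I` does
  have hall : ∀ D : Set β, D.Finite → D.Nonempty → D ⊆ J \ I →
      ∃ T ⊆ I, (G.ends T).ncard + k = T.ncard + 1 ∧ G.ends D ⊆ G.ends T := by
    intro D hD
    induction D, hD using Set.Finite.induction_on with
    | empty => exact fun h => absurd h (by simp)
    | @insert a s has hs ih =>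
      intro _ hsub
      obtain ⟨T, hT, hTt, hTe⟩ := hex a (hsub (mem_insert a s)).1 (hsub (mem_insert a s)).2
      rcases s.eq_empty_or_nonempty with rfl | hne
      · exact ⟨T, hT, hTt, by simpa using hTe⟩
      obtain ⟨T', hT', hTt', hTe'⟩ := ih hne ((subset_insert a s).trans hsub)
      refine ⟨T ∪ T', union_subset hT hT', htight T hT T' hT' hTt hTt', ?_⟩
      rw [insert_eq, ends_union, ends_union]
      exact union_subset_union hTe hTe'
  have hdiff := Set.ncard_inter_add_ncard_sdiff_eq_ncard J I hJf
  have hdiff' := Set.ncard_inter_add_ncard_sdiff_eq_ncard I J hIf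
  rw [inter_comm] at hdiff'
  have hpos : 0 < (J \ I).ncard := by omega
  obtain ⟨T, hT, hTt, hTe⟩ := hall (J \ I) (hJf.subset sdiff_subset)
    ((Set.ncard_pos (hJf.subset sdiff_subset)).1 hpos) subset_rfl
  have hTf := hIf.subset hT
  have h1 := hJ ((J \ I) ∪ (J ∩ T)) (union_subset sdiff_subset inter_subset_left)
  have h2 : ((J \ I) ∪ (J ∩ T)).ncard = (J \ I).ncard + (J ∩ T).ncard := by
    refine Set.ncard_union_eq ?_ (hJf.subset sdiff_subset) (hJf.subset inter_subset_left)
    rw [Set.disjoint_left]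
    exact fun x hx hx' => hx.2 (hT hx'.2)
  have h3 : (G.ends ((J \ I) ∪ (J ∩ T))).ncard ≤ (G.ends T).ncard := by
    refine Set.ncard_le_ncard ?_ (G.finite_ends hTf)
    rw [ends_union]
    exact union_subset hTe (G.ends_mono inter_subset_right)
  have h4 := Set.ncard_inter_add_ncard_sdiff_eq_ncard T J hTf
  rw [inter_comm] at h4
  have h5 : (T \ J).ncard ≤ (I \ J).ncard :=
    Set.ncard_le_ncard (sdiff_subset_sdiff_left hT) (hIf.subset sdiff_subset)
  omega

/-! ### The `k`-circular matroid -/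

/-- The `k`-circular matroid `Mₖ(G)` of a finite graph `G`, for `k ≥ 1`: the matroid on the edge
set of `G` in which a set is independent if it contains no member of `𝒞ₖ(G)`. -/
def kCircularMatroid (G : Graph α β) (hG : G.IsFinite) (k : ℕ) (hk : 1 ≤ k) : Matroid β :=
  (IndepMatroid.ofFinite hG.2 (fun I => I ⊆ E(G) ∧ ∀ C ∈ G.circuitFamily k, ¬ C ⊆ I)
    ⟨empty_subset _, by
      rw [forall_circuitFamily_not_subset_iff G hk (empty_subset _) finite_empty]
      intro Y hY
      rw [subset_empty_iff.1 hY, ncard_empty]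
      omega⟩
    (fun _ _ hJ hIJ => ⟨hIJ.trans hJ.1, fun C hC hCI => hJ.2 C hC (hCI.trans hIJ)⟩)
    (by
      rintro I J ⟨hIE, hI⟩ ⟨hJE, hJ⟩ hlt
      rw [forall_circuitFamily_not_subset_iff G hk hIE (hG.2.subset hIE)] at hI
      rw [forall_circuitFamily_not_subset_iff G hk hJE (hG.2.subset hJE)] at hJ
      obtain ⟨e, heJ, heI, h⟩ := G.circuitFamily_aug hG.2 hIE hJE hI hJ hlt
      have hE : insert e I ⊆ E(G) := insert_subset (hJE heJ) hIE
      exact ⟨e, heJ, heI, hE,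
        (forall_circuitFamily_not_subset_iff G hk hE (hG.2.subset hE)).2 h⟩)
    (fun _ hI => hI.1)).matroid

/-- A member of `𝒞ₖ(G)` properly contains no
edge set of excess at least `k`. -/
lemma ncard_lt_of_subset_circuitFamily (G : Graph α β) {k : ℕ} {C Y : Set β} (hfin : C.Finite)
    (hC : C ∈ G.circuitFamily k) (hYC : Y ⊆ C) (hne : Y ≠ C) :
    Y.ncard < (G.ends Y).ncard + k := by
  classical
  by_contra! hcon
  obtain ⟨hCE, hex, hiso, hleaf, hcomp⟩ := hC
  rw [excess_edgeInduce G hCE] at hex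
  set H := G.edgeInduce C with hH
  have hendfin := G.finite_ends hfin
  have hDf : (C \ Y).Finite := hfin.subset sdiff_subset
  have hWf : (G.ends C \ G.ends Y).Finite := hendfin.subset sdiff_subset
  set D := hDf.toFinset with hD
  set W := hWf.toFinset with hW
  have hcardD : D.card + Y.ncard = C.ncard := by
    rw [hD, ← Set.ncard_eq_toFinset_card _ hDf]
    exact Set.ncard_sdiff_add_ncard_of_subset hYC hfin
  have hcardW : W.card + (G.ends Y).ncard = (G.ends C).ncard := by
    rw [hW, ← Set.ncard_eq_toFinset_card _ hWf]
    exact Set.ncard_sdiff_add_ncard_of_subset (G.ends_mono hYC) hendfin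
  have hcard : D.card ≤ W.card := by omega
  have hWmem : ∀ w, w ∈ W ↔ w ∈ G.ends C ∧ w ∉ G.ends Y := fun w => by
    simp [hW]
  have hDmem : ∀ e, e ∈ D ↔ e ∈ C ∧ e ∉ Y := fun e => by simp [hD]
  have hincD : ∀ w ∈ W, H.incidenceSet w ⊆ D := by
    intro w hw e he
    obtain ⟨heC, hew⟩ := (edgeInduce_inc ..).1 he
    exact (hDmem e).2 ⟨heC, fun heY => ((hWmem w).1 hw).2 ⟨e, heY, hew⟩⟩
  have hdeg2 : ∀ w ∈ W, 2 ≤ ∑ e ∈ D, H.multEnd e w := by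
    intro w hw
    have hwV : w ∈ V(H) := ((hWmem w).1 hw).1
    obtain ⟨e, he⟩ := hiso w hwV
    have h0 : 1 ≤ ∑ e ∈ D, H.multEnd e w := by
      refine le_trans ?_ (Finset.single_le_sum (f := fun e => H.multEnd e w)
        (fun _ _ => Nat.zero_le _) (hincD w hw he))
      simp [multEnd, he]
    have h1 : ∑ e ∈ D, H.multEnd e w ≠ 1 := by
      intro h1
      refine hleaf w ⟨hwV, ?_⟩
      rw [H.eDegree_eq_sum (hincD w hw), h1]
      rfl
    omega
  have hle2 : ∀ e ∈ D, ∑ w ∈ W, H.multEnd e w ≤ 2 := by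
    intro e he
    obtain ⟨x, y, hxy⟩ := G.exists_isLink_of_mem_edgeSet (hCE ((hDmem e).1 he).1)
    rw [H.sum_multEnd ((edgeInduce_isLink ..).2 ⟨((hDmem e).1 he).1, hxy⟩)]
    split_ifs <;> omega
  have hsum := Finset.sum_comm (s := W) (t := D) (f := fun x e => H.multEnd e x)
  have hlow : W.card * 2 ≤ ∑ w ∈ W, ∑ e ∈ D, H.multEnd e w := by
    simpa using Finset.card_nsmul_le_sum W _ 2 hdeg2
  have hup : ∑ e ∈ D, ∑ w ∈ W, H.multEnd e w ≤ D.card * 2 := by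
    simpa using Finset.sum_le_card_nsmul D _ 2 hle2
  have hdeg : ∀ w ∈ W, H.eDegree w = 2 := by
    intro w hw
    rw [H.eDegree_eq_sum (hincD w hw)]
    have h1 : ∑ w ∈ W, 2 = ∑ w ∈ W, ∑ e ∈ D, H.multEnd e w := by
      simp only [Finset.sum_const, smul_eq_mul]
      omega
    rw [← (Finset.sum_eq_sum_iff_of_le hdeg2).1 h1 w hw]
    rfl
  have hends : ∀ e ∈ D, ∀ x y, H.IsLink e x y → x ∈ W ∧ y ∈ W := by
    intro e he x y hxy
    have h1 : ∑ e ∈ D, ∑ w ∈ W, H.multEnd e w = ∑ e ∈ D, 2 := by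
      simp only [Finset.sum_const, smul_eq_mul]
      omega
    have h2 := (Finset.sum_eq_sum_iff_of_le hle2).1 h1 e he
    rw [H.sum_multEnd hxy] at h2
    by_contra hcon'
    split_ifs at h2 <;> first | omega | tauto
  obtain ⟨e, heC, heY⟩ : ∃ e ∈ C, e ∉ Y := by
    by_contra! h
    exact hne (hYC.antisymm h)
  obtain ⟨w, w', hw⟩ := G.exists_isLink_of_mem_edgeSet (hCE heC)
  have hwW : w ∈ W :=
    (hends e ((hDmem e).2 ⟨heC, heY⟩) w w' ((edgeInduce_isLink ..).2 ⟨heC, hw⟩)).1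
  have hstep : ∀ x ∈ W, ∀ y, H.Adj x y → y ∈ W := by
    rintro x hx y ⟨f, hf⟩
    exact (hends f (hincD x hx hf.inc_left) x y hf).2
  let R : Set α := {x | Relation.ReflTransGen H.Adj w x}
  have hRW : ∀ x ∈ R, x ∈ W := by
    intro x hx
    induction (hx : Relation.ReflTransGen H.Adj w x) with
    | refl => exact hwW
    | tail _ hadj ih => exact hstep _ ih _ hadj
  have hRV : R ⊆ V(H) := fun x hx => ((hWmem x).1 (hRW x hx)).1
  have hlink : ∀ f x y, x ∈ R → ((H.induce R).IsLink f x y ↔ H.IsLink f x y) := by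
    intro f x y hx
    simp only [induce_isLink]
    exact ⟨fun h => h.1, fun h => ⟨h, hx, Relation.ReflTransGen.tail hx ⟨f, h⟩⟩⟩
  have hcl : (H.induce R) ≤c H := by
    refine IsClosedSubgraph.mk' (induce_le hRV) ?_
    rintro f x ⟨y, hxy⟩ hx
    exact ((hlink f x y hx).2 hxy).edge_mem
  have hreach : ∀ x ∈ R, Relation.ReflTransGen (H.induce R).Adj w x := by
    intro x hx
    induction (hx : Relation.ReflTransGen H.Adj w x) with
    | refl => exact .refl
    | @tail b c hb hadj ih =>
      obtain ⟨f, hf⟩ := hadj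
      exact ih.tail ⟨f, (hlink f b c hb).2 hf⟩
  have hsymm : ∀ x, Relation.ReflTransGen (H.induce R).Adj w x →
      Relation.ReflTransGen (H.induce R).Adj x w := by
    intro x hx
    induction hx with
    | refl => exact .refl
    | tail _ hadj ih => exact Relation.ReflTransGen.head hadj.symm ih
  have hconn : (H.induce R).IsConnected :=
    ⟨⟨w, Relation.ReflTransGen.refl⟩, fun x hx y hy =>
      (hsymm x (hreach x hx)).trans (hreach y hy)⟩
  refine hcomp (H.induce R) ⟨hcl, hconn⟩ ⟨W.finite_toSet.subset hRW, hconn, ?_⟩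
  intro x hx
  have hx' : x ∈ R := hx
  rw [← hdeg x (hRW x hx'), eDegree, eDegree]
  congr 2
  · ext f
    simp only [mem_incidenceSet, Inc, hlink f x _ hx']
  · ext f
    simp only [mem_loopSet, IsLoopAt, hlink f x _ hx']

/-- The circuits of `Mₖ(G)` are exactly the members of `𝒞ₖ(G)`. -/
theorem kCircularMatroid_isCircuit_iff (G : Graph α β) (hG : G.IsFinite) (k : ℕ) (hk : 1 ≤ k)
    (C : Set β) : (G.kCircularMatroid hG k hk).IsCircuit C ↔ C ∈ G.circuitFamily k := by
  have hindep : ∀ I, (G.kCircularMatroid hG k hk).Indep I ↔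
      I ⊆ E(G) ∧ ∀ C ∈ G.circuitFamily k, ¬ C ⊆ I := fun _ => Iff.rfl
  have hground : (G.kCircularMatroid hG k hk).E = E(G) := rfl
  rw [Matroid.isCircuit_iff_forall_ssubset, Matroid.Dep, hindep, hground]
  constructor
  · rintro ⟨⟨h1, hCE⟩, h2⟩
    push Not at h1
    obtain ⟨C', hC', hsub⟩ := h1 hCE
    rcases hsub.eq_or_ssubset with rfl | hss
    · exact hC'
    · exact absurd subset_rfl (((hindep C').1 (h2 hss)).2 C' hC')
  · intro hC
    have hfin := hG.2.subset hC.1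
    refine ⟨⟨fun h => h.2 C hC subset_rfl, hC.1⟩, fun I hI => ?_⟩
    rw [hindep, forall_circuitFamily_not_subset_iff G hk (hI.subset.trans hC.1)
      (hfin.subset hI.subset)]
    refine ⟨hI.subset.trans hC.1, fun Y hY => ?_⟩
    exact G.ncard_lt_of_subset_circuitFamily hfin hC (hY.trans hI.subset)
      (fun h => hI.2 (h ▸ hY))

end Graph

namespace Matroid

variable {β : Type*}

/-- A matroid is connected if it has no loops, no coloops, and every two of its elements belong
to a common circuit. -/
def IsConnectedMatroid (M : Matroid β) : Prop :=
  (∀ e, ¬ M.IsLoop e) ∧ (∀ e, ¬ M.IsColoop e) ∧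
    ∀ e ∈ M.E, ∀ f ∈ M.E, e ≠ f → ∃ C, M.IsCircuit C ∧ e ∈ C ∧ f ∈ C

/-- A non-separating cocircuit of a connected matroid `M` is a cocircuit whose deletion leaves a
connected matroid. -/
def IsNonseparatingCocircuit (M : Matroid β) (K : Set β) : Prop :=
  M.IsCocircuit K ∧ (M.delete K).IsConnectedMatroid

end Matroid

/-- A vertex `x` is `k`-big if its star has more than `ρ* + 1` edges, where `ρ*` is the corank of
`Mₖ(G)`, that is, the rank of the dual matroid. -/
def Graph.IsBigVertex {α β : Type*} (G : Graph α β) (hG : G.IsFinite) (k : ℕ) (hk : 1 ≤ k)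
    (x : α) : Prop :=
  (G.kCircularMatroid hG k hk).dual.eRank + 1 < (G.vertexStar x).encard

/-! ### Cocircuits in terms of bases. -/

namespace Matroid

variable {β : Type*} {M : Matroid β}

/-! The matroid determines almost all the stars by a rank count. An independent set `I` has at most
`|ends I| + k - 1` elements, and a nonempty coloop-free edge set attains this bound
(`ncard_add_one_eq_of_isBasis`). So the rank of `Mₖ(G)` is `|V(G)| + k - 1`, and every
representation has the same number of vertices.

Let `K` be a cocircuit whose deletion leaves no coloops. Its complement is a hyperplane, of rank
`|V(G)| + k - 2`, so it covers all vertices but one, and `K` must be the star of that vertex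
(`exists_eq_vertexStar_of_isCocircuit`). Applied to `G'`, this makes every star `S(x, G)` with `x ≠
v` a star of `G'`. These stars are distinct, so exactly one vertex `v'` of `G'` is left over.

It remains to match `S(v, G)` with `S(v', G')`. An edge at `v'` but not at `v` is not a loop of `G`,
so it would have three ends in `G'`. Conversely, if an edge `e` at `v` is not at `v'`, then the
edges off `v` together with `e` avoid `v'` in `G'`, hence do not span. But in `G` they span
(`ncard_add_le_of_isBasis_insert`): this is where it matters that `v` is not `k`-big and that `G -
v` has no tree component, the latter by the Hall-type count `ncard_le_ncard_touching`. -/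

/-- Since `K` is a circuit of the dual, `K \ {e}` extends to a dual base, which must miss `e`; its
complement is the required base. -/
lemma IsCocircuit.exists_isBase_inter_eq_singleton {K : Set β} (hK : M.IsCocircuit K) {e : β}
    (he : e ∈ K) : ∃ B, M.IsBase B ∧ B ∩ K = {e} := by
  obtain ⟨B, hB, hKB⟩ := (hK.isCircuit.sdiff_singleton_indep he).exists_isBase_superset
  have heB : e ∉ B := by
    intro heB
    refine hK.isCircuit.not_indep (hB.indep.subset fun f hf => ?_)
    by_cases hfe : f = e
    · exact hfe ▸ heB
    · exact hKB ⟨hf, hfe⟩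
  refine ⟨M.E \ B, hB.compl_isBase_of_dual, ?_⟩
  ext f
  constructor
  · rintro ⟨hf, hfK⟩
    by_contra hfe
    exact hf.2 (hKB ⟨hfK, hfe⟩)
  · rintro rfl
    exact ⟨⟨hK.subset_ground he, heB⟩, he⟩

/-- A base meeting `K` only in `e` restricts to a basis of the complement of `K`, for a
cocircuit `K`. -/
lemma IsCocircuit.isBasis_sdiff_singleton [M.RankFinite] {K B : Set β} (hK : M.IsCocircuit K)
    {e : β} (hB : M.IsBase B) (hBK : B ∩ K = {e}) : M.IsBasis (B \ {e}) (M.E \ K) := by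
  have heB : e ∈ B ∩ K := hBK ▸ Set.mem_singleton e
  have hsub : B \ {e} ⊆ M.E \ K := fun f hf =>
    ⟨hB.subset_ground hf.1, fun hfK => hf.2 (hBK ▸ ⟨hf.1, hfK⟩)⟩
  refine (hB.indep.subset Set.sdiff_subset).isBasis_of_forall_insert hsub fun f hf => ?_
  refine ⟨fun hind => ?_, Set.insert_subset hf.1.1 (hsub.trans Set.sdiff_subset)⟩
  have hcard : (insert f (B \ {e})).encard = B.encard := by
    rw [Set.encard_insert_of_notMem hf.2, Set.encard_sdiff_singleton_add_one heB.1]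
  -- This set has the size of a base but misses `K`, so its complement would be a dual base
  -- containing the dual circuit `K`.
  have hbase : M.IsBase (insert f (B \ {e})) := by
    obtain ⟨B', hB', hsub'⟩ := hind.exists_isBase_superset
    rwa [(hB'.finite.subset hsub').eq_of_subset_of_encard_le hsub'
      (by rw [hcard, hB'.encard_eq_encard_of_isBase hB])]
  have h := hbase.compl_isBase_dual
  refine hK.isCircuit.not_indep (h.indep.subset fun g hg => ⟨hK.subset_ground hg, ?_⟩)
  rintro (rfl | hgB)
  · exact hf.1.2 hg
  · exact (hsub hgB).2 hg

/-- Absence of coloops, in the form needed for the rank formula `ncard_add_one_eq_of_isBasis`. -/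
lemma exists_isBasis_notMem_of_delete {K : Set β} (h : ∀ e, ¬ (M.delete K).IsColoop e) (f : β) :
    ∃ J, M.IsBasis J (M.E \ K) ∧ f ∉ J := by
  have h1 := h f
  rw [isColoop_iff_forall_mem_isBase] at h1
  push Not at h1
  obtain ⟨J, hJ, hfJ⟩ := h1
  exact ⟨J, delete_isBase_iff.1 hJ, hfJ⟩

end Matroid

namespace Graph

open Set

variable {α α' β : Type*}

/-! ### Rank in the `k`-circular matroid, and recognition of vertex stars. -/

section KCircular

variable {G : Graph α β} {hG : G.IsFinite} {k : ℕ} {hk : 1 ≤ k}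

lemma kCircularMatroid_ground : (G.kCircularMatroid hG k hk).E = E(G) := rfl

instance : (G.kCircularMatroid hG k hk).Finite := ⟨hG.2⟩

lemma kCircularMatroid_indep_iff {I : Set β} : (G.kCircularMatroid hG k hk).Indep I ↔
    I ⊆ E(G) ∧ ∀ Y ⊆ I, Y.ncard < (G.ends Y).ncard + k := by
  have h : (G.kCircularMatroid hG k hk).Indep I ↔
    I ⊆ E(G) ∧ ∀ C ∈ G.circuitFamily k, ¬ C ⊆ I := Iff.rfl
  rw [h]
  exact and_congr_right fun hI =>
    forall_circuitFamily_not_subset_iff G hk hI (hG.2.subset hI)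

lemma ncard_lt_of_isBasis {I X : Set β} (hI : (G.kCircularMatroid hG k hk).IsBasis I X) :
    I.ncard < (G.ends X).ncard + k := by
  have h1 := (kCircularMatroid_indep_iff.1 hI.indep).2 I subset_rfl
  have h2 := Set.ncard_le_ncard (G.ends_mono hI.subset)
    (G.finite_ends (hG.2.subset hI.subset_ground))
  omega

/-- If a basis `I` of `X` is not all of `X`, then some subset of `I` of excess `k - 1` covers
the ends of the edges in `X \ I`. -/
lemma exists_tight_of_isBasis {I X : Set β} (hI : (G.kCircularMatroid hG k hk).IsBasis I X)
    (hne : I ≠ X) :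
    ∃ T ⊆ I, (G.ends T).ncard + k = T.ncard + 1 ∧ G.ends (X \ I) ⊆ G.ends T := by
  obtain ⟨hIE, hI'⟩ := kCircularMatroid_indep_iff.1 hI.indep
  have hIf := hG.2.subset hIE
  have hex : ∀ e ∈ X, e ∉ I → ∃ T ⊆ I, (G.ends T).ncard + k = T.ncard + 1 ∧
      G.ends {e} ⊆ G.ends T := by
    intro e heX heI
    have hdep : ¬ (G.kCircularMatroid hG k hk).Indep (insert e I) := fun h =>
      (hI.insert_dep ⟨heX, heI⟩).not_indep h
    rw [kCircularMatroid_indep_iff] at hdep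
    push Not at hdep
    obtain ⟨Y, hYI, hY⟩ := hdep (insert_subset (hI.subset_ground heX) hIE)
    have hYf : Y.Finite := (hIf.insert e).subset hYI
    have heY : e ∈ Y := by
      by_contra h
      have := hI' Y ((subset_insert_iff_of_notMem h).1 hYI)
      omega
    have hTI : Y \ {e} ⊆ I := by
      rintro f ⟨hf, hfe⟩
      exact (hYI hf).resolve_left hfe
    have h1 := hI' _ hTI
    have h2 := Set.ncard_sdiff_singleton_add_one heY hYf
    have hsub : G.ends (Y \ {e}) ⊆ G.ends Y := G.ends_mono sdiff_subset
    have h3 := Set.ncard_le_ncard hsub (G.finite_ends hYf)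
    -- `Y` has excess at least `k` and `Y \ {e}` at most `k - 1`, so removing `e` loses no end and
    -- leaves a set of excess exactly `k - 1`.
    refine ⟨Y \ {e}, hTI, by omega, ?_⟩
    rw [Set.eq_of_subset_of_ncard_le hsub (by omega) (G.finite_ends hYf)]
    exact G.ends_mono (by simpa using heY)
  let P : Set β → Prop := fun T => T ⊆ I ∧ (G.ends T).ncard + k = T.ncard + 1
  have hPfin : {T | P T}.Finite := hIf.finite_subsets.subset fun T hT => hT.1
  obtain ⟨e, heX, heI⟩ : ∃ e ∈ X, e ∉ I := by
    by_contra! h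
    exact hne (hI.subset.antisymm h)
  obtain ⟨T₀, hT₀, hT₀t, -⟩ := hex e heX heI
  obtain ⟨T, hT⟩ := hPfin.exists_maximal ⟨T₀, hT₀, hT₀t⟩
  refine ⟨T, hT.1.1, hT.1.2, ?_⟩
  rintro x ⟨f, hf, hx⟩
  obtain ⟨Z, hZ, hZt, hfZ⟩ := hex f hf.1 hf.2
  have hTf := hIf.subset hT.1.1
  have hZf := hIf.subset hZ
  have h2 := hT.1.2
  have h3 := hI' (T ∪ Z) (union_subset hT.1.1 hZ)
  -- The bound holds for an empty intersection too, as `k ≥ 1`; so tight sets are closed under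
  -- union, and a maximal one contains all the others.
  have h4 := hI' (T ∩ Z) (inter_subset_left.trans hT.1.1)
  have h5 := Set.ncard_union_add_ncard_inter T Z hTf hZf
  have h6 := Set.ncard_union_add_ncard_inter (G.ends T) (G.ends Z) (G.finite_ends hTf)
    (G.finite_ends hZf)
  have h7 := Set.ncard_le_ncard (G.ends_inter_subset T Z)
    ((G.finite_ends hTf).subset inter_subset_left)
  rw [← ends_union] at h6
  have hTZ : P (T ∪ Z) := ⟨union_subset hT.1.1 hZ, by omega⟩
  exact G.ends_mono (subset_union_right.trans (hT.2 hTZ subset_union_left))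
    (hfZ ⟨f, rfl, hx⟩)

/-- A nonempty edge set on which the `k`-circular matroid has no coloop has the largest rank that
its number of ends allows. -/
lemma ncard_add_one_eq_of_isBasis {I X : Set β} (hne : X.Nonempty)
    (hI : (G.kCircularMatroid hG k hk).IsBasis I X)
    (hX : ∀ f, ∃ J, (G.kCircularMatroid hG k hk).IsBasis J X ∧ f ∉ J) :
    I.ncard + 1 = (G.ends X).ncard + k := by
  have hcard : ∀ J, (G.kCircularMatroid hG k hk).IsBasis J X → J.ncard = I.ncard := fun J hJ => by
    rw [Set.ncard, Set.ncard, hJ.encard_eq_encard hI]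
  have hIX : I ≠ X := by
    rintro rfl
    obtain ⟨e, he⟩ := hne
    obtain ⟨J, hJ, heJ⟩ := hX e
    have h1 := hcard J hJ
    rw [Set.eq_of_subset_of_ncard_le hJ.subset h1.ge (hG.2.subset hI.subset_ground)] at heJ
    exact heJ he
  obtain ⟨T, hTI, hT, hends⟩ := exists_tight_of_isBasis hI hIX
  have hIf : I.Finite := hG.2.subset hI.indep.subset_ground
  have hXf : X.Finite := hG.2.subset hI.subset_ground
  -- Let `f ∈ I \ T` and let `J` be a basis avoiding `f`. The part of `J` in `T ∪ (X \ I)` has its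
  -- ends in `ends T`, so at most `|T|` elements; the rest lies in `I \ T` without `f`. Hence `|J| <
  -- |I|`.
  have hIT : I = T := by
    refine (hTI.antisymm fun f hf => ?_).symm
    by_contra hfT
    obtain ⟨J, hJ, hfJ⟩ := hX f
    have hJf : J.Finite := hXf.subset hJ.subset
    have h1 := (kCircularMatroid_indep_iff.1 hJ.indep).2 (J ∩ (T ∪ (X \ I))) inter_subset_left
    have h2 : (G.ends (J ∩ (T ∪ (X \ I)))).ncard ≤ (G.ends T).ncard := by
      refine Set.ncard_le_ncard ((G.ends_mono inter_subset_right).trans ?_)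
        (G.finite_ends (hIf.subset hTI))
      rw [ends_union]
      exact union_subset subset_rfl hends
    have h3 : (J \ (T ∪ (X \ I))).ncard ≤ (I \ insert f T).ncard := by
      refine Set.ncard_le_ncard ?_ (hIf.subset sdiff_subset)
      rintro g ⟨hgJ, hg⟩
      refine ⟨by_contra fun h => hg (Or.inr ⟨hJ.subset hgJ, h⟩), ?_⟩
      rintro (rfl | h)
      · exact hfJ hgJ
      · exact hg (Or.inl h)
    have h4 := Set.ncard_inter_add_ncard_sdiff_eq_ncard J (T ∪ (X \ I)) hJf
    have h5 := Set.ncard_sdiff_add_ncard_of_subset (insert_subset hf hTI) hIf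
    have h6 := Set.ncard_insert_of_notMem hfT (hIf.subset hTI)
    have h7 := hcard J hJ
    omega
  subst hIT
  have hX' : G.ends X = G.ends I := by
    refine (Set.Subset.antisymm ?_ (G.ends_mono hI.subset))
    rw [← union_sdiff_cancel hI.subset, ends_union]
    exact union_subset subset_rfl hends
  rw [hX']
  exact hT.symm

lemma ends_edgeSet (hiso : G.NoIsolatedVertex) : G.ends E(G) = V(G) := by
  ext x
  exact ⟨fun ⟨_, _, h⟩ => h.vertex_mem, fun h => (hiso x h).imp fun _ he => ⟨he.edge_mem, he⟩⟩

/-- The rank formula for `X = E(G)`: the number of vertices can be read off the matroid. -/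
lemma ncard_add_one_eq_of_isBase (hiso : G.NoIsolatedVertex)
    (hcol : ∀ e, ¬ (G.kCircularMatroid hG k hk).IsColoop e) (hne : E(G).Nonempty) {B : Set β}
    (hB : (G.kCircularMatroid hG k hk).IsBase B) : B.ncard + 1 = V(G).ncard + k := by
  rw [← ends_edgeSet hiso]
  refine ncard_add_one_eq_of_isBasis hne hB.isBasis_ground fun f => ?_
  have h1 := hcol f
  rw [Matroid.isColoop_iff_forall_mem_isBase] at h1
  push Not at h1
  obtain ⟨J, hJ, hfJ⟩ := h1
  exact ⟨J, hJ.isBasis_ground, hfJ⟩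

/-- A cocircuit whose deletion leaves no coloops is the star of a vertex. -/
lemma exists_eq_vertexStar_of_isCocircuit (hiso : G.NoIsolatedVertex)
    (hcol : ∀ e, ¬ (G.kCircularMatroid hG k hk).IsColoop e) (hV : 2 ≤ V(G).ncard) {K : Set β}
    (hK : (G.kCircularMatroid hG k hk).IsCocircuit K)
    (hKcol : ∀ e, ¬ ((G.kCircularMatroid hG k hk).delete K).IsColoop e) :
    (∃ x ∈ V(G), K = G.vertexStar x) ∧ (G.ends (E(G) \ K)).ncard + 1 = V(G).ncard := by
  have hne : E(G).Nonempty := hK.nonempty.mono hK.subset_ground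
  obtain ⟨e, he⟩ := hK.nonempty
  obtain ⟨B, hB, hBK⟩ := hK.exists_isBase_inter_eq_singleton he
  have hBf : B.Finite := hG.2.subset hB.subset_ground
  have heB : e ∈ B ∩ K := hBK ▸ mem_singleton e
  have hB' := hK.isBasis_sdiff_singleton hB hBK
  rw [kCircularMatroid_ground] at hB'
  have hr := ncard_add_one_eq_of_isBase hiso hcol hne hB
  have h1 := Set.ncard_sdiff_singleton_add_one heB.1 hBf
  -- A base has `|V(G)| + k - 1 ≥ 2` elements, and only one of those of `B` lies in `K`.
  have hHne : (E(G) \ K).Nonempty := by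
    refine Set.Nonempty.mono hB'.subset ((Set.ncard_pos (hBf.subset sdiff_subset)).1 ?_)
    omega
  have h2 := ncard_add_one_eq_of_isBasis hHne hB' (Matroid.exists_isBasis_notMem_of_delete hKcol)
  refine ⟨?_, by omega⟩
  obtain ⟨x, hxV, hx⟩ : ∃ x ∈ V(G), x ∉ G.ends (E(G) \ K) :=
    Set.exists_mem_notMem_of_ncard_lt_ncard (by omega)
      (G.finite_ends (hG.2.subset sdiff_subset))
  refine ⟨x, hxV, Set.Subset.antisymm (fun f hf => ?_) fun f hf => ?_⟩
  · by_contra hfx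
    -- If `f` is not at `x`, this base avoids `x`: it has `|V(G)| + k - 1` edges on at most `|V(G)|
    -- - 1` vertices, too many for an independent set.
    obtain ⟨B₁, hB₁, hBK₁⟩ := hK.exists_isBase_inter_eq_singleton hf
    have hr₁ := ncard_add_one_eq_of_isBase hiso hcol hne hB₁
    have h3 := (kCircularMatroid_indep_iff.1 hB₁.indep).2 B₁ subset_rfl
    have h4 : G.ends B₁ ⊆ V(G) \ {x} := by
      rintro y ⟨g, hg, hy⟩
      refine ⟨hy.vertex_mem, ?_⟩
      rintro rfl
      by_cases hgK : g ∈ K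
      · have : g = f := by
          have : g ∈ B₁ ∩ K := ⟨hg, hgK⟩
          rwa [hBK₁] at this
        exact hfx (this ▸ hy)
      · exact hx ⟨g, ⟨hy.edge_mem, hgK⟩, hy⟩
    have h5 := Set.ncard_le_ncard h4 (hG.1.subset sdiff_subset)
    have h6 := Set.ncard_sdiff_singleton_add_one hxV hG.1
    omega
  · by_contra hfK
    exact hx ⟨f, ⟨Inc.edge_mem hf, hfK⟩, hf⟩

end KCircular

/-! ### Vertex sets touching few edges, and tree components. -/

/-- The edges with at least one end in `W`. -/
def touching (G : Graph α β) (W : Set α) : Set β := {e | ∃ w ∈ W, G.Inc e w}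

lemma touching_subset (G : Graph α β) (W : Set α) : G.touching W ⊆ E(G) :=
  fun _ ⟨_, _, h⟩ => h.edge_mem

lemma touching_mono (G : Graph α β) {W W' : Set α} (h : W ⊆ W') : G.touching W ⊆ G.touching W' :=
  fun _ ⟨w, hw, he⟩ => ⟨w, h hw, he⟩

/-- If every proper subset of `W` touches at least as many edges as it has elements, but `W` does
not, then `W` is the vertex set of a tree component. -/
lemma isComponent_isTreeGraph_of_minimal {G : Graph α β} (hG : G.IsFinite) {W : Set α}
    (hWV : W ⊆ V(G)) (hW : (G.touching W).ncard < W.ncard)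
    (hmin : ∀ U ⊆ W, U ≠ W → U.ncard ≤ (G.touching U).ncard) :
    (G.induce W).IsComponent G ∧ (G.induce W).IsTreeGraph := by
  have hWf := hG.1.subset hWV
  have htf : ∀ U, (G.touching U).Finite := fun U => hG.2.subset (G.touching_subset U)
  have hne : W.Nonempty := (Set.ncard_pos hWf).1 (by omega)
  -- By minimality `W \ {w}` already touches `|W| - 1` edges, and `W` touches no more. So no edge
  -- has `w` as its only end in `W`, and `W` is closed under adjacency.
  have hdel : ∀ w ∈ W, G.touching (W \ {w}) = G.touching W := by
    intro w hw
    have h1 := hmin (W \ {w}) sdiff_subset fun h => (h.symm ▸ hw : w ∈ W \ {w}).2 rfl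
    have h2 := Set.ncard_sdiff_singleton_add_one hw hWf
    exact Set.eq_of_subset_of_ncard_le (G.touching_mono sdiff_subset) (by omega) (htf W)
  have hstep : ∀ e x y, G.IsLink e x y → x ∈ W → y ∈ W := by
    intro e x y hxy hx
    have h1 : e ∈ G.touching (W \ {x}) := hdel x hx ▸ ⟨x, hx, hxy.inc_left⟩
    obtain ⟨w, hw, hew⟩ := h1
    rcases hew.eq_or_eq_of_isLink hxy with rfl | rfl
    · exact absurd rfl hw.2
    · exact hw.1
  -- Otherwise `F` and the edges touching `W \ U` would together number at least `|W|`. Taking for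
  -- `U` a set of reachable vertices gives connectedness; taking a cycle, with `F` its edges, gives
  -- acyclicity.
  have hsplit : ∀ U ⊆ W, U.Nonempty → ∀ F ⊆ G.touching W, U.ncard ≤ F.ncard →
      Disjoint F (G.touching (W \ U)) → False := by
    intro U hU hUne F hF hFc hdis
    obtain ⟨u, hu⟩ := hUne
    have h1 := hmin (W \ U) sdiff_subset fun h => (h.symm ▸ hU hu : u ∈ W \ U).2 hu
    have h2 := Set.ncard_sdiff_add_ncard_of_subset hU hWf
    have h3 := Set.ncard_union_eq hdis ((htf W).subset hF) (htf _)
    have h4 := Set.ncard_le_ncard (union_subset hF (G.touching_mono (sdiff_subset : W \ U ⊆ W)))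
      (htf W)
    omega
  have hcl : (G.induce W) ≤c G := by
    refine IsClosedSubgraph.mk' (induce_le hWV) ?_
    rintro f x ⟨y, hxy⟩ hx
    exact (show (G.induce W).IsLink f x y from ⟨hxy, hx, hstep f x y hxy hx⟩).edge_mem
  have hconn : (G.induce W).IsConnected := by
    refine ⟨hne, fun x hx y hy => ?_⟩
    let R : Set α := {z | z ∈ W ∧ Relation.ReflTransGen (G.induce W).Adj x z}
    have hxR : x ∈ R := ⟨hx, .refl⟩
    by_contra hcon
    have hRW : R ⊆ W := fun z hz => hz.1
    refine hsplit R hRW ⟨x, hxR⟩ _ (G.touching_mono hRW)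
      (hmin R hRW fun h => hcon (h.symm ▸ hy : y ∈ R).2) ?_
    rw [Set.disjoint_left]
    rintro e ⟨a, ha, ea⟩ ⟨b, hb, eb⟩
    obtain ⟨c, hc⟩ := ea
    rcases eb.eq_or_eq_of_isLink hc with rfl | rfl
    · exact hb.2 ha
    · exact hb.2 ⟨hb.1, ha.2.tail ⟨e, hc, ha.1, hb.1⟩⟩
  refine ⟨⟨hcl, hconn⟩, hconn, fun H hH hcyc => ?_⟩
  have hHG : H ≤ G := hH.trans hcl.le
  have hVW : V(H) ⊆ W := hH.vertexSet_mono
  refine hsplit V(H) hVW hcyc.2.1.1 E(H) ?_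
    (hcyc.ncard_eq (hG.2.subset hHG.edgeSet_mono)).ge ?_
  · intro e he
    obtain ⟨x, y, hxy⟩ := H.exists_isLink_of_mem_edgeSet he
    exact ⟨x, hVW hxy.left_mem, (hxy.mono hHG).inc_left⟩
  · rw [Set.disjoint_left]
    rintro e he ⟨b, hb, eb⟩
    obtain ⟨x, y, hxy⟩ := H.exists_isLink_of_mem_edgeSet he
    rcases eb.eq_or_eq_of_isLink (hxy.mono hHG) with rfl | rfl
    · exact hb.2 hxy.left_mem
    · exact hb.2 hxy.right_mem

/-- In a finite graph without tree components every set of vertices touches at least as many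
edges as it has elements. -/
lemma ncard_le_ncard_touching {G : Graph α β} (hG : G.IsFinite)
    (htree : ∀ T : Graph α β, T.IsComponent G → ¬ T.IsTreeGraph) {W : Set α} (hW : W ⊆ V(G)) :
    W.ncard ≤ (G.touching W).ncard := by
  by_contra! hcon
  let P : Set α → Prop := fun W => W ⊆ V(G) ∧ (G.touching W).ncard < W.ncard
  have hPfin : {W | P W}.Finite := hG.1.finite_subsets.subset fun W hW => hW.1
  obtain ⟨U, hU⟩ := hPfin.exists_minimal ⟨W, hW, hcon⟩
  obtain ⟨h1, h2⟩ := isComponent_isTreeGraph_of_minimal hG hU.1.1 hU.1.2 fun Z hZ hne => by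
    by_contra! h
    exact hne (hZ.antisymm (hU.2 (⟨hZ.trans hU.1.1, h⟩ : P Z) hZ))
  exact htree _ h1 h2

/-! ### The spanning property of the edges off `v` plus one edge at `v`. -/

lemma IsFinite.deleteVerts {G : Graph α β} (hG : G.IsFinite) (X : Set α) :
    (G.deleteVerts X).IsFinite :=
  ⟨hG.1.subset deleteVerts_le.vertexSet_mono, hG.2.subset deleteVerts_le.edgeSet_mono⟩

/-- If `v` is not `k`-big and `G - v` has no tree component, then the edges outside the star of
`v` together with any one edge of the star span the `k`-circular matroid. -/
lemma ncard_add_le_of_isBasis_insert {G : Graph α β} {hG : G.IsFinite} {k : ℕ} {hk : 1 ≤ k}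
    (hiso : G.NoIsolatedVertex)
    (hcol : ∀ e, ¬ (G.kCircularMatroid hG k hk).IsColoop e) {v : α}
    (hbig : ¬ G.IsBigVertex hG k hk v)
    (htree : ∀ T : Graph α β, T.IsComponent (G.deleteVerts {v}) → ¬ T.IsTreeGraph)
    {e : β} (he : G.Inc e v) {I : Set β}
    (hI : (G.kCircularMatroid hG k hk).IsBasis I (insert e (E(G) \ G.vertexStar v))) :
    V(G).ncard + k ≤ I.ncard + 1 := by
  have hSE : G.vertexStar v ⊆ E(G) := fun f hf => Inc.edge_mem hf
  set X := insert e (E(G) \ G.vertexStar v) with hX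
  have hXf : X.Finite := hG.2.subset hI.subset_ground
  have hIf : I.Finite := hXf.subset hI.subset
  have heS : e ∉ E(G) \ G.vertexStar v := fun h => h.2 he
  by_cases hIX : I = X
  · obtain ⟨B, hB⟩ := (G.kCircularMatroid hG k hk).exists_isBase
    have hr := ncard_add_one_eq_of_isBase hiso hcol ⟨e, he.edge_mem⟩ hB
    have h1 := Set.ncard_insert_of_notMem heS (hG.2.subset sdiff_subset)
    have h2 := Set.ncard_sdiff_add_ncard_of_subset hSE hG.2
    have hBE : B ⊆ E(G) := hB.subset_ground
    have h3 := Set.ncard_sdiff_add_ncard_of_subset hBE hG.2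
    -- When `X` is independent its size decides: `|X| = |E(G)| - |S(v)| + 1`, which is at least the
    -- rank exactly because `v` is not `k`-big.
    have h4 : (G.vertexStar v).ncard ≤ (E(G) \ B).ncard + 1 := by
      rw [IsBigVertex, ← hB.compl_isBase_dual.encard_eq_eRank, not_lt,
        kCircularMatroid_ground] at hbig
      rw [← (hG.2.subset hSE).cast_ncard_eq,
        ← (hG.2.subset (sdiff_subset : E(G) \ B ⊆ E(G))).cast_ncard_eq] at hbig
      exact_mod_cast hbig
    rw [hIX, hX]
    omega
  · obtain ⟨T, hTI, hT, hends⟩ := exists_tight_of_isBasis hI hIX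
    have hTf := hIf.subset hTI
    have hTV : G.ends T ⊆ V(G) := fun x ⟨_, _, h⟩ => h.vertex_mem
    have h1 := Set.ncard_sdiff_add_ncard_of_subset hTI hIf
    have h2 := Set.ncard_sdiff_add_ncard_of_subset hTV hG.1
    -- `T` covers all ends of `X \ I`, so edges of `X` reaching a vertex outside `ends T` are
    -- counted in `I` beyond `T`. It then suffices to find `|V(G) \ ends T|` of them.
    have hout : ∀ f ∈ X, ∀ w, G.Inc f w → w ∉ G.ends T → f ∈ I \ T := by
      intro f hf w hfw hw
      refine ⟨by_contra fun hfI => hw (hends ⟨f, ⟨hf, hfI⟩, hfw⟩), fun hfT => hw ⟨f, hfT, hfw⟩⟩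
    set W := V(G) \ G.ends T with hW
    have hWf : W.Finite := hG.1.subset sdiff_subset
    have h3 := ncard_le_ncard_touching (hG.deleteVerts {v}) htree (W := W \ {v}) (by
      rw [vertexSet_deleteVerts]
      exact sdiff_subset_sdiff_left sdiff_subset)
    have htouch : ∀ f ∈ (G.deleteVerts {v}).touching (W \ {v}),
        f ∈ E(G) \ G.vertexStar v ∧ f ∈ I \ T := by
      rintro f ⟨w, hw, y, hwy⟩
      obtain ⟨hwy, hwv, hyv⟩ := (deleteVerts_isLink ..).1 hwy
      have hf : f ∈ E(G) \ G.vertexStar v := by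
        refine ⟨hwy.edge_mem, fun hfv => ?_⟩
        rcases Inc.eq_or_eq_of_isLink hfv hwy with rfl | rfl
        · exact hwv rfl
        · exact hyv rfl
      exact ⟨hf, hout f (mem_insert_of_mem _ hf) w hwy.inc_left hw.1.2⟩
    have hle : W.ncard ≤ (I \ T).ncard := by
      -- The graph `G - v` supplies one edge for each vertex of `W` other than `v`; if `v ∈ W`, the
      -- edge `e` supplies the missing one.
      by_cases hvW : v ∈ W
      · have h4 := Set.ncard_sdiff_singleton_add_one hvW hWf
        have h5 : insert e ((G.deleteVerts {v}).touching (W \ {v})) ⊆ I \ T :=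
          insert_subset (hout e (mem_insert ..) v he hvW.2) fun f hf => (htouch f hf).2
        have h6 := Set.ncard_le_ncard h5 (hIf.subset sdiff_subset)
        rw [Set.ncard_insert_of_notMem (fun h => heS (htouch e h).1)
          ((hIf.subset sdiff_subset).subset fun f hf => (htouch f hf).2)] at h6
        omega
      · rw [sdiff_singleton_eq_self hvW] at h3 htouch
        exact h3.trans (Set.ncard_le_ncard (fun f hf => (htouch f hf).2)
          (hIf.subset sdiff_subset))
    omega

/-- A bijection of the vertex sets that preserves incidence is a strong isomorphism. -/
lemma stronglyIsomorphic_of_inc {G : Graph α β} {G' : Graph α' β} (hE : E(G) = E(G'))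
    (ν : V(G) ≃ V(G')) (h : ∀ e (x : V(G)), G.Inc e x ↔ G'.Inc e (ν x)) :
    G.StronglyIsomorphic G' := by
  refine ⟨hE, ν, fun e x y => ?_⟩
  rw [isLink_iff_inc, isLink_iff_inc, h, h]
  refine and_congr_right fun _ => and_congr_right fun _ => ⟨fun H z hz => ?_, fun H z hz => ?_⟩
  · obtain ⟨w, hw⟩ := ν.surjective ⟨z, hz.vertex_mem⟩
    have hzw : z = ν w := by rw [hw]
    subst hzw
    rcases H w ((h e w).2 hz) with h1 | h1
    · exact Or.inl (by rw [Subtype.ext h1])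
    · exact Or.inr (by rw [Subtype.ext h1])
  · have h1 := H _ ((h e ⟨z, hz.vertex_mem⟩).1 hz)
    exact h1.imp (fun h => Subtype.ext_iff.1 (ν.injective (Subtype.ext h)))
        fun h => Subtype.ext_iff.1 (ν.injective (Subtype.ext h))

end Graph

/-! ### Matching the stars of the two graphs. -/

open Graph Set in
theorem mainTheorem9 {α α' β : Type*} (G : Graph α β) (G' : Graph α' β)
    (hG : G.IsFinite) (hG' : G'.IsFinite)
    (hiso : G.NoIsolatedVertex) (hiso' : G'.NoIsolatedVertex)
    (k : ℕ) (hk : 1 ≤ k)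
    (hconn : (G.kCircularMatroid hG k hk).IsConnectedMatroid)
    (v : α) (hv : v ∈ G.vertexSet)
    (hstar : ∀ x ∈ G.vertexSet, x ≠ v →
      (G.kCircularMatroid hG k hk).IsNonseparatingCocircuit (G.vertexStar x))
    (hloop : ∀ p x, G.IsLoopAt p x → x = v)
    (hbig : ¬ G.IsBigVertex hG k hk v)
    (htree : ∀ T : Graph α β, T.IsComponent (G.deleteVerts {v}) → ¬ T.IsTreeGraph)
    (hM : G'.kCircularMatroid hG' k hk = G.kCircularMatroid hG k hk) :
    G.vertexStars = G'.vertexStars ∧ G.StronglyIsomorphic G' := by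
  classical
  have hE : G'.edgeSet = G.edgeSet := congrArg Matroid.E hM
  have hcol := hconn.2.1
  have hcol' : ∀ e, ¬ (G'.kCircularMatroid hG' k hk).IsColoop e := hM ▸ hcol
  have hcard : G'.vertexSet.ncard = G.vertexSet.ncard := by
    obtain ⟨B, hB⟩ := (G.kCircularMatroid hG k hk).exists_isBase
    obtain ⟨e, he⟩ := hiso v hv
    have h1 := ncard_add_one_eq_of_isBase hiso hcol ⟨e, he.edge_mem⟩ hB
    have h2 := ncard_add_one_eq_of_isBase hiso' hcol' ⟨e, hE ▸ he.edge_mem⟩ (hM ▸ hB)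
    omega
  have htwo : ∀ x ∈ G.vertexSet, x ≠ v → 2 ≤ G.vertexSet.ncard := fun x hx hxv => by
    have h := Set.ncard_le_ncard (insert_subset hx (singleton_subset_iff.2 hv)) hG.1
    rwa [Set.ncard_pair hxv] at h
  have hex : ∀ x : G.vertexSet, x.1 ≠ v →
      ∃ y : G'.vertexSet, G.vertexStar x = G'.vertexStar y := fun x hxv => by
    have hK := hstar x x.2 hxv
    rw [← hM] at hK
    obtain ⟨⟨y, hy, h⟩, -⟩ := exists_eq_vertexStar_of_isCocircuit hiso' hcol'
      (hcard ▸ htwo x x.2 hxv) hK.1 hK.2.2.1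
    exact ⟨⟨y, hy⟩, h⟩
  have hinj : ∀ x ∈ G.vertexSet, x ≠ v → ∀ y ∈ G.vertexSet,
      G.vertexStar x = G.vertexStar y → x = y := fun x hx hxv y hy hxy => by
    have hK := hstar x hx hxv
    have h1 := (exists_eq_vertexStar_of_isCocircuit hiso hcol (htwo x hx hxv) hK.1 hK.2.2.1).2
    by_contra hne
    -- Two vertices with the same star would both be missed by the complement, which misses only one
    -- vertex.
    have h2 : G.ends (G.edgeSet \ G.vertexStar x) ⊆ G.vertexSet \ {x, y} := by
      rintro z ⟨f, hf, hz⟩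
      refine ⟨hz.vertex_mem, ?_⟩
      rintro (rfl | rfl)
      · exact hf.2 hz
      · exact hf.2 (hxy ▸ hz)
    have h3 := Set.ncard_le_ncard h2 (hG.1.subset sdiff_subset)
    have h4 := Set.ncard_sdiff_add_ncard_of_subset
      (insert_subset hx (singleton_subset_iff.2 hy)) hG.1
    rw [Set.ncard_pair hne] at h4
    omega
  choose φ hφ using hex
  have : Finite G.vertexSet := hG.1
  have : Finite G'.vertexSet := hG'.1
  -- If `φ` were onto, a section `ψ` of it would be an injection between vertex sets of equal size,
  -- hence onto, yet it never takes the value `v`.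
  obtain ⟨v', hv'⟩ : ∃ v' : G'.vertexSet, ∀ x hx, φ x hx ≠ v' := by
    by_contra! hcon
    choose ψ hψ₁ hψ₂ using hcon
    have h1 : Function.Injective ψ := fun a b hab => by
      rw [← hψ₂ a, ← hψ₂ b]
      congr 1
    have h2 := ((Nat.bijective_iff_injective_and_card ψ).2
      ⟨h1, by rw [Nat.card_coe_set_eq, Nat.card_coe_set_eq, hcard]⟩).2 ⟨v, hv⟩
    obtain ⟨a, ha⟩ := h2
    exact hψ₁ a (by rw [ha])
  let ν : G.vertexSet → G'.vertexSet := fun x => if h : x.1 = v then v' else φ x h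
  have hνv : ν ⟨v, hv⟩ = v' := dif_pos rfl
  have hνφ : ∀ x (h : x.1 ≠ v), ν x = φ x h := fun x h => dif_neg h
  have hν : ∀ x : G.vertexSet, x.1 ≠ v → G.vertexStar x = G'.vertexStar (ν x) := fun x h => by
    rw [hνφ x h, ← hφ]
  have hνinj : Function.Injective ν := by
    intro x y hxy
    by_cases hx : x.1 = v <;> by_cases hy : y.1 = v
    · exact Subtype.ext (hx.trans hy.symm)
    · rw [hνφ y hy, show x = ⟨v, hv⟩ from Subtype.ext hx, hνv] at hxy
      exact absurd hxy.symm (hv' y hy)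
    · rw [hνφ x hx, show y = ⟨v, hv⟩ from Subtype.ext hy, hνv] at hxy
      exact absurd hxy (hv' x hx)
    · exact Subtype.ext (hinj x x.2 hx y y.2 (by rw [hν x hx, hν y hy, hxy]))
  have hνbij : Function.Bijective ν := (Nat.bijective_iff_injective_and_card ν).2
    ⟨hνinj, by rw [Nat.card_coe_set_eq, Nat.card_coe_set_eq, hcard]⟩
  have hsub : G'.vertexStar v' ⊆ G.vertexStar v := by
    intro f hf
    by_contra hfv
    have hfE : f ∈ G.edgeSet := hE ▸ Inc.edge_mem hf
    obtain ⟨x, y, hxy⟩ := G.exists_isLink_of_mem_edgeSet hfE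
    have hxv : x ≠ v := fun h => hfv (h ▸ hxy.inc_left)
    have hyv : y ≠ v := fun h => hfv (h ▸ hxy.inc_right)
    have hne : x ≠ y := fun h => hxv (hloop f x (h ▸ hxy))
    have h1 : G'.Inc f (ν ⟨x, hxy.left_mem⟩) :=
      (hν ⟨x, hxy.left_mem⟩ hxv).subset hxy.inc_left
    have h2 : G'.Inc f (ν ⟨y, hxy.right_mem⟩) :=
      (hν ⟨y, hxy.right_mem⟩ hyv).subset hxy.inc_right
    have h3 : G'.Inc f (ν ⟨v, hv⟩) := hνv ▸ hf
    have hd : ∀ a b : G.vertexSet, a.1 ≠ b.1 → (ν a).1 ≠ (ν b).1 := fun a b hab h =>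
      hab (congrArg Subtype.val (hνinj (Subtype.ext h)))
    -- In `G'` the edge `f` now meets the three distinct vertices `ν x`, `ν y` and `v'`.
    obtain ⟨z, hz⟩ := h1
    rcases h2.eq_or_eq_of_isLink hz with h | h
    · exact hd _ _ hne.symm h
    rcases h3.eq_or_eq_of_isLink hz with h' | h'
    · exact hd _ _ hxv.symm h'
    · exact hd _ _ hyv.symm (h'.trans h.symm)
  have heq : G.vertexStar v = G'.vertexStar v' := by
    refine Set.Subset.antisymm (fun e he => ?_) hsub
    by_contra hev
    have hXE : insert e (G.edgeSet \ G.vertexStar v) ⊆ G.edgeSet :=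
      insert_subset (Inc.edge_mem he) sdiff_subset
    obtain ⟨I, hI⟩ := (G.kCircularMatroid hG k hk).exists_isBasis _ hXE
    have h1 := ncard_add_le_of_isBasis_insert hiso hcol hbig htree he hI
    have h2 := ncard_lt_of_isBasis (hM ▸ hI : (G'.kCircularMatroid hG' k hk).IsBasis I _)
    -- By `hsub` no edge off `v` is at `v'` in `G'`, and neither is `e`; so the rank in `G'` is at
    -- most `|V(G')| + k - 2`, one less than `h1` requires.
    have h3 : G'.ends (insert e (G.edgeSet \ G.vertexStar v)) ⊆ G'.vertexSet \ {v'.1} := by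
      rintro z ⟨f, hf, hz⟩
      refine ⟨hz.vertex_mem, ?_⟩
      rintro rfl
      rcases hf with rfl | hf
      · exact hev hz
      · exact hf.2 (hsub hz)
    have h4 := Set.ncard_le_ncard h3 (hG'.1.subset sdiff_subset)
    have h5 := Set.ncard_sdiff_singleton_add_one v'.2 hG'.1
    omega
  have hall : ∀ x : G.vertexSet, G.vertexStar x = G'.vertexStar (ν x) := fun x => by
    by_cases hx : x.1 = v
    · rw [show x = ⟨v, hv⟩ from Subtype.ext hx, hνv]
      exact heq
    · exact hν x hx
  refine ⟨?_, stronglyIsomorphic_of_inc hE.symm (Equiv.ofBijective ν hνbij)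
    fun e x => Set.ext_iff.1 (hall x) e⟩
  ext S
  constructor
  · rintro ⟨x, hx, rfl⟩
    exact ⟨_, (ν ⟨x, hx⟩).2, hall ⟨x, hx⟩⟩
  · rintro ⟨y, hy, rfl⟩
    obtain ⟨x, hx⟩ := hνbij.2 ⟨y, hy⟩
    exact ⟨x, x.2, by rw [hall x, hx]⟩
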